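/- Let $\mathcal G$ be a finite connected graph, regarded as a relational structure with one binary relation (adjacency), let $k\in\mathbb N$, and suppose that the complete graph $\mathcal K_k$ is a minor of $\mathcal G$, i.e. $\mathcal K_k$ can be obtained (up to isomorphism) from $\mathcal G$ by repeatedly deleting vertices, deleting edges and contracting edges. Then $$d_{\mathcal G}(m)=\Omega\!\left(\frac{m^{k/4}}{\log^{(3k-1)/2} m}\right)\qquad(m\to\infty),$$ where the implied constant may depend on $\mathcal G$ and $k$. Here a factorisation circuit $C$ for sets $A$ and $B$ is a finite acyclic directed graph with a unique sink, in which every node (gate) without incoming edges is labelled by some $\{a\mapsto b\}$ with $a\in A$, $b\in B$, and every other gate is labelled $\cup$ or $\times$. The domain of an input gate $\{a\mapsto b\}$ is $\{a\}$, and the domain of any other gate is the union of the domains of its children. The circuit is well-defined if all children of a $\cup$-gate have the same domain as the gate, and the children of a $\times$-gate have pairwise disjoint domains. Each gate $g$ then computes a set $S_g$ of mappings $\operatorname{dom}(g)\to B$: $\{\{a\mapsto b\}\}$ for an input gate, the union of the sets of its children for a $\cup$-gate, and $\{h_1\cup\dots\cup h_r : h_i\in S_{g_i}\}$ for a $\times$-gate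 with children $g_1,\dots,g_r$. A d-representation of $\operatorname{Hom}(\mathcal A,\mathcal B)$ is a well-defined factorisation circuit for the universes of $\mathcal A$ and $\mathcal B$ whose sink computes exactly the set of all homomorphisms from $\mathcal A$ to $\mathcal B$. Its size $\|C\|$ is the number of gates plus the number of edges. Let $d(\mathcal A,\mathcal B)$ be the smallest size of a d-representation of $\operatorname{Hom}(\mathcal A,\mathcal B)$, with value $0$ if there is no homomorphism (and hence no d-representation). The size $\|\mathcal B\|$ of a relational structure is the total number of tuples in its relations; a structure is connected if its Gaifman graph is. Finally, $d_{\mathcal A}(m)$ is the maximum of $d(\mathcal A,\mathcal B)$ over all finite connected structures $\mathcal B$ over the signature of $\mathcal A$ with $\|\mathcal B\|\le m$. -/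

import Mathlib

open FirstOrder FirstOrder.Language

/-! ### Minors of graphs -/

namespace SimpleGraph

universe u w

/-- The graph obtained from `G` by contracting `u` and `v` into one vertex. The new vertex is
called `u`, so that the vertex set is `V` without `v`; the new vertex is adjacent to all
neighbours of `u` and of `v`, and no loop or multiple edge is created. -/
def contractPair {V : Type u} (G : SimpleGraph V) (u v : V) : SimpleGraph {x : V // x ≠ v} :=
  SimpleGraph.fromRel fun x y => G.Adj x y ∨ ((x : V) = u ∧ G.Adj v y)

/-- `IsMinorOf H G`: (an isomorphic copy of) `H` can be obtained from `G` by repeatedly deleting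
vertices, deleting edges and contracting edges. -/
inductive IsMinorOf {W : Type w} (H : SimpleGraph W) : ∀ {V : Type u}, SimpleGraph V → Prop
  | iso {V : Type u} {G : SimpleGraph V} (e : H ≃g G) : IsMinorOf H G
  | deleteVertex {V : Type u} {G : SimpleGraph V} (v : V)
      (h : IsMinorOf H (G.induce {x : V | x ≠ v})) : IsMinorOf H G
  | deleteEdge {V : Type u} {G : SimpleGraph V} (u v : V) (huv : G.Adj u v)
      (h : IsMinorOf H (G.deleteEdges {s(u, v)})) : IsMinorOf H G
  | contractEdge {V : Type u} {G : SimpleGraph V} (u v : V) (huv : G.Adj u v)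
      (h : IsMinorOf H (G.contractPair u v)) : IsMinorOf H G

end SimpleGraph

/-! ### Relational structures -/

namespace RelStr

/-- The size `‖M‖` of a relational structure: the total number of tuples in its relations. -/
noncomputable def size (L : Language) (M : Type*) [L.Structure M] : ℕ∞ :=
  ENat.card (Σ R : (Σ n, L.Relations n), {x : Fin R.1 → M // Structure.RelMap R.2 x})

/-- The Gaifman graph of a structure: two distinct elements are adjacent if they occur together
in a tuple of some relation. -/
def gaifman (L : Language) (M : Type*) [L.Structure M] : SimpleGraph M where
  Adj a b := a ≠ b ∧ ∃ (n : ℕ) (R : L.Relations n) (x : Fin n → M),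
    Structure.RelMap R x ∧ a ∈ Set.range x ∧ b ∈ Set.range x
  symm := ⟨fun _ _ ⟨h, n, R, x, hx, ha, hb⟩ => ⟨h.symm, n, R, x, hx, hb, ha⟩⟩
  loopless := ⟨fun _ h => h.1 rfl⟩

/-- A structure is connected if its Gaifman graph is. -/
def Connected (L : Language) (M : Type*) [L.Structure M] : Prop :=
  (gaifman L M).Connected

end RelStr

/-! ### Factorisation circuits -/

/-- The labels of the gates: `{a ↦ b}` for inputs, `∪`, and `×`. -/
inductive GateLabel (A B : Type*)
  | input (a : A) (b : B)
  | union
  | prod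

/-- A factorisation circuit for `A` and `B`: a finite acyclic directed graph with a unique sink;
the gates labelled by inputs are exactly those without incoming wires, all other gates are
`∪`-gates or `×`-gates. `wire g' g` means that there is a wire from `g'` to `g`, that is, `g'` is
a child of `g`. -/
structure FactCircuit (A B : Type*) where
  Gate : Type
  finite : Finite Gate
  wire : Gate → Gate → Prop
  acyclic : ∀ g, ¬ Relation.TransGen wire g g
  sink : Gate
  sink_iff : ∀ g, (∀ g', ¬ wire g g') ↔ g = sink
  label : Gate → GateLabel A B
  input_iff : ∀ g, (∃ a b, label g = GateLabel.input a b) ↔ ∀ g', ¬ wire g' g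

namespace FactCircuit

variable {A B : Type*}

/-- `C.MemDom g a`: the element `a` is in the domain of the gate `g`. -/
inductive MemDom (C : FactCircuit A B) : C.Gate → A → Prop
  | input {g : C.Gate} {a : A} {b : B} (hg : C.label g = GateLabel.input a b) : MemDom C g a
  | step {g g' : C.Gate} {a : A} (hw : C.wire g' g) (h : MemDom C g' a) : MemDom C g a

/-- The domain of a gate. -/
def dom (C : FactCircuit A B) (g : C.Gate) : Set A := {a | C.MemDom g a}

/-- A circuit is well-defined if the children of every `∪`-gate have the same domain as the gate,
and the children of every `×`-gate have pairwise disjoint domains. -/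
def WellDefined (C : FactCircuit A B) : Prop :=
  (∀ g, C.label g = GateLabel.union → ∀ g', C.wire g' g → C.dom g' = C.dom g) ∧
  (∀ g, C.label g = GateLabel.prod → ∀ g₁ g₂, C.wire g₁ g → C.wire g₂ g → g₁ ≠ g₂ →
    Disjoint (C.dom g₁) (C.dom g₂))

/-- `C.Produces g h`: the partial mapping `h`, given by its graph (a set of pairs), belongs to
the set `S_g` of mappings computed at the gate `g`. -/
inductive Produces (C : FactCircuit A B) : C.Gate → Set (A × B) → Prop
  | input {g : C.Gate} {a : A} {b : B} (hg : C.label g = GateLabel.input a b) :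
      Produces C g {(a, b)}
  | union {g g' : C.Gate} {h : Set (A × B)} (hg : C.label g = GateLabel.union)
      (hw : C.wire g' g) (h' : Produces C g' h) : Produces C g h
  | prod {g : C.Gate} (hg : C.label g = GateLabel.prod) (f : C.Gate → Set (A × B))
      (hf : ∀ g', C.wire g' g → Produces C g' (f g')) :
      Produces C g {p | ∃ g', C.wire g' g ∧ p ∈ f g'}

/-- The set `S_C` of mappings represented by the circuit. -/
def mappings (C : FactCircuit A B) : Set (Set (A × B)) := {h | C.Produces C.sink h}

/-- The size `‖C‖`: the number of gates plus the number of wires. -/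
noncomputable def size (C : FactCircuit A B) : ℕ :=
  Nat.card C.Gate + Nat.card {p : C.Gate × C.Gate // C.wire p.1 p.2}

/-- `C` is a d-representation of `Hom(A, B)`: it is well-defined and represents exactly the set
of all homomorphisms from `A` to `B`. -/
def IsDRep (L : Language) [L.Structure A] [L.Structure B] (C : FactCircuit A B) : Prop :=
  C.WellDefined ∧ C.mappings = {h | ∃ φ : A →[L] B, h = {p | p.2 = φ p.1}}

end FactCircuit

/-! ### Representation size -/

/-- `d(A, B)`: the smallest size of a d-representation of `Hom(A, B)`. It is `0` if there is none,
that is, if there is no homomorphism from `A` to `B`. -/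
noncomputable def minRepSize (L : Language) (A B : Type*) [L.Structure A] [L.Structure B] : ℕ :=
  sInf {s | ∃ C : FactCircuit A B, C.IsDRep L ∧ C.size = s}

/-- `d_A(m)`: the maximum of `d(A, B)` over all finite connected structures `B` with `‖B‖ ≤ m`.
Up to isomorphism, the universe of `B` is `Fin n` for some `n`. -/
noncomputable def worstRepSize (L : Language) (A : Type*) [L.Structure A] (m : ℕ) : ℕ :=
  sSup {d | ∃ (n : ℕ) (_ : L.Structure (Fin n)), RelStr.Connected L (Fin n) ∧
    RelStr.size L (Fin n) ≤ (m : ℕ∞) ∧ d = minRepSize L A (Fin n)}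

/-- `d_G(m)` for a graph `G`, viewed as a structure with one binary relation, the adjacency
relation. -/
noncomputable def SimpleGraph.worstRepSize {V : Type*} (G : SimpleGraph V) (m : ℕ) : ℕ :=
  letI : Language.graph.Structure V := G.structure
  _root_.worstRepSize Language.graph V m

/-!
The lower bound is witnessed by an explicit target. Fix a model of `K_k` in `G`, with branch sets
`X_1, ..., X_k`. The elements of the target are pairs of a vertex of `G` and a vector of
`𝔽₂ ^ (2 * r)`; along an edge of `G` inside a branch set the vector must not change, and along an
edge between two branch sets the vectors must be orthogonal. Homomorphisms lying over the identity
of `G` then amount to `k`-tuples of pairwise orthogonal vectors, and choosing the vectors one after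
the other shows that there are at least `2 ^ (2 * r * k - k ^ 2)` of these
(`two_pow_le_card_orthogonalTuples_mul`). On the other hand two orthogonal sets of vectors have
sizes with product at most `4 ^ r`, so that one of them has at most `2 ^ r` elements
(`ncard_mul_ncard_le_of_orthogonal`).

For a gate `g` of a representation consider the set of mappings computed at `g` and the set of
contexts completing all of them to homomorphisms, both restricted to mappings over the identity.
Each combination of a mapping and a context is a homomorphism, so the orthogonality bound says that
either the mappings or the contexts take at most `2 ^ r` values on each branch set
(`FactCircuit.IsEncoding.smallTraces_or`). Given a homomorphism, start at the sink, which has few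
contexts, and follow its derivation downwards as long as the gate reached has few contexts. The walk
ends at a gate or at a wire with few mappings below and few contexts above
(`FactCircuit.IsEncoding.exists_node`). Such a gate or wire accounts for at most `(2 * 2 ^ r) ^ k`
homomorphisms, so there must be at least `2 ^ (r * k)` gates and wires, up to a constant factor
(`FactCircuit.IsEncoding.card_le`). As the target has `m = O(16 ^ r)` tuples, this is of order
`m ^ (k / 4)`, and the logarithmic factor is not even needed. Only for `k = 0` does it work in the
wrong direction; there the bound for `k = 1` applies, because `G` has a vertex.

The infimum and the supremum which define `d_G(m)` are genuine: a representation exists whenever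
there is a homomorphism (`FactCircuit.exists_isDRep`), and only finitely many connected structures
have at most `m` tuples (`bddAbove_minRepSize`).
-/

/-! ### Minor models -/

namespace SimpleGraph

universe u

/-- `c` describes a minor model of `H` in `G`: the fibre of `c` over `some w` is the branch set of
the vertex `w`, and the vertices with `c v = none` are not used. Branch sets are nonempty and
connected, and adjacent vertices of `H` have branch sets joined by an edge. Connectedness is
encoded by saying that a set of vertices which is closed under walking along an edge inside a
branch set contains this branch set as soon as it meets it. -/
structure IsMinorModel {W V : Type*} (H : SimpleGraph W) (G : SimpleGraph V) (c : V → Option W) :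
    Prop where
  nonempty : ∀ w, ∃ v, c v = some w
  connected : ∀ (s : Set V) (w : W),
    (∀ x y, G.Adj x y → c x = some w → c y = some w → x ∈ s → y ∈ s) →
      ∀ x y, c x = some w → c y = some w → x ∈ s → y ∈ s
  adj : ∀ w w', H.Adj w w' → ∃ x y, c x = some w ∧ c y = some w' ∧ G.Adj x y

theorem IsMinorOf.exists_isMinorModel {W : Type*} {H : SimpleGraph W} {V : Type u}
    {G : SimpleGraph V} (h : IsMinorOf H G) : ∃ c, IsMinorModel H G c := by
  classical
  induction h with
  | @iso V G e =>
    refine ⟨fun v => some (e.symm v), fun w => ⟨e w, by simp⟩, ?_, ?_⟩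
    · intro s w _ x y hx hy hs
      have : x = y := e.symm.injective (Option.some_injective _ (hx.trans hy.symm))
      exact this ▸ hs
    · intro w w' hw
      exact ⟨e w, e w', by simp, by simp, e.map_adj_iff.2 hw⟩
  | @deleteVertex V G v _ ih =>
    obtain ⟨c, hc⟩ := ih
    set c' : V → Option W := fun x => if hx : x ≠ v then c ⟨x, hx⟩ else none with hc'
    have hne : ∀ (x : {x : V | x ≠ v}), c' x = c x := fun x => by
      rw [hc']; exact dif_pos x.2
    have hval : ∀ x w, c' x = some w → ∃ hx : x ≠ v, c ⟨x, hx⟩ = some w := fun x w hx => by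
      rw [hc'] at hx
      dsimp only at hx
      split_ifs at hx with hxv
      exact ⟨hxv, hx⟩
    refine ⟨c', ?_, ?_, ?_⟩
    · intro w
      obtain ⟨x, hx⟩ := hc.nonempty w
      exact ⟨x, (hne x).trans hx⟩
    · intro s w hs x y hx hy hxs
      obtain ⟨hxv, hx⟩ := hval x w hx
      obtain ⟨hyv, hy⟩ := hval y w hy
      refine hc.connected {z | (z : V) ∈ s} w ?_ ⟨x, hxv⟩ ⟨y, hyv⟩ hx hy hxs
      intro a b hab ha hb has
      exact hs a b hab ((hne a).trans ha) ((hne b).trans hb) has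
    · intro w w' hw
      obtain ⟨x, y, hx, hy, hxy⟩ := hc.adj w w' hw
      exact ⟨x, y, (hne x).trans hx, (hne y).trans hy, hxy⟩
  | @deleteEdge V G u v _ _ ih =>
    obtain ⟨c, hc⟩ := ih
    refine ⟨c, hc.nonempty, ?_, ?_⟩
    · intro s w hs
      exact hc.connected s w fun x y hxy => hs x y (G.deleteEdges_le _ hxy)
    · intro w w' hw
      obtain ⟨x, y, hx, hy, hxy⟩ := hc.adj w w' hw
      exact ⟨x, y, hx, hy, G.deleteEdges_le _ hxy⟩
  | @contractEdge V G u v huv _ ih =>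
    obtain ⟨c, hc⟩ := ih
    -- the vertex `v` joins the branch set of `u`
    set p : V → {x : V // x ≠ v} := fun x => if hx : x ≠ v then ⟨x, hx⟩ else ⟨u, huv.ne⟩ with hp
    have hpx : ∀ x : {x : V // x ≠ v}, p x = x := fun x => dif_pos x.2
    have hpv : p v = ⟨u, huv.ne⟩ := by simp [hp]
    have hpu : p u = ⟨u, huv.ne⟩ := hpx ⟨u, huv.ne⟩
    refine ⟨fun x => c (p x), ?_, ?_, ?_⟩
    · intro w
      obtain ⟨x, hx⟩ := hc.nonempty w
      exact ⟨x, by simpa only [hpx] using hx⟩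
    · intro s w hs x y hx hy hxs
      have hp_mem : ∀ z, c (p z) = some w → (z ∈ s ↔ (p z : V) ∈ s) := by
        intro z hz
        by_cases hzv : z = v
        · subst hzv
          rw [hpv] at hz ⊢
          exact ⟨hs _ _ huv.symm (by rwa [hpv]) (by rwa [hpu]),
            hs _ _ huv (by rwa [hpu]) (by rwa [hpv])⟩
        · rw [hpx ⟨z, hzv⟩]
      rw [hp_mem y hy]
      rw [hp_mem x hx] at hxs
      refine hc.connected {z | (z : V) ∈ s} w ?_ (p x) (p y) hx hy hxs
      intro a b hab ha hb has
      have key : ∀ a b : {x : V // x ≠ v}, c a = some w → c b = some w →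
          (G.Adj a b ∨ ((a : V) = u ∧ G.Adj v b)) → ((a : V) ∈ s ↔ (b : V) ∈ s) := by
        rintro a b ha hb (hab | ⟨hau, hvb⟩)
        · exact ⟨hs _ _ hab (by rwa [hpx]) (by rwa [hpx]),
            hs _ _ hab.symm (by rwa [hpx]) (by rwa [hpx])⟩
        · have ha' : a = ⟨u, huv.ne⟩ := Subtype.ext hau
          have hv : c (p v) = some w := by rw [hpv, ← ha', ha]
          have hva := hp_mem v hv
          rw [hpv, ← ha'] at hva
          rw [← hva]
          exact ⟨hs _ _ hvb hv (by rwa [hpx]), hs _ _ hvb.symm (by rwa [hpx]) hv⟩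
      rcases (fromRel_adj _ _ _).1 hab with ⟨_, h | h⟩
      · exact (key a b ha hb h).1 has
      · exact (key b a hb ha h).2 has
    · have key : ∀ (a b : {x : V // x ≠ v}), (G.Adj a b ∨ ((a : V) = u ∧ G.Adj v b)) →
          ∃ x y, p x = a ∧ p y = b ∧ G.Adj x y := by
        rintro a b (hab | ⟨hau, hvb⟩)
        · exact ⟨a, b, hpx a, hpx b, hab⟩
        · exact ⟨v, b, hpv.trans (Subtype.ext hau.symm), hpx b, hvb⟩
      intro w w' hw
      obtain ⟨a, b, ha, hb, hab⟩ := hc.adj w w' hw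
      rcases (fromRel_adj _ _ _).1 hab with ⟨_, h | h⟩
      · obtain ⟨x, y, hx, hy, hxy⟩ := key a b h
        exact ⟨x, y, by rw [hx, ha], by rw [hy, hb], hxy⟩
      · obtain ⟨x, y, hx, hy, hxy⟩ := key b a h
        exact ⟨y, x, by rw [hy, ha], by rw [hx, hb], hxy.symm⟩

/-- A single vertex is a minor model of the one-vertex complete graph. -/
theorem exists_isMinorModel_one {V : Type*} [Nonempty V] (G : SimpleGraph V) :
    ∃ c, IsMinorModel (completeGraph (Fin 1)) G c := by
  classical
  obtain ⟨v⟩ := ‹Nonempty V›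
  have hv : ∀ x w, (if x = v then some (0 : Fin 1) else none) = some w → x = v := by
    intro x w hx
    by_contra hxv
    simp [hxv] at hx
  refine ⟨fun x => if x = v then some 0 else none,
    fun w => ⟨v, by simp [Subsingleton.elim w 0]⟩, ?_, ?_⟩
  · intro s w _ x y hx hy hxs
    rwa [hv y w hy, ← hv x w hx]
  · intro w w' hw
    exact absurd (Subsingleton.elim w w') hw.ne

end SimpleGraph

/-! ### Orthogonal tuples over the field with two elements -/

/-- The tuples of `k` pairwise orthogonal vectors of `𝔽₂ ^ d`. -/
def orthogonalTuples (k d : ℕ) : Set (Fin k → Fin d → ZMod 2) :=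
  {x | ∀ i j, i ≠ j → x i ⬝ᵥ x j = 0}

theorem card_le_card_orthogonal_mul {k d : ℕ} (x : Fin k → Fin d → ZMod 2) :
    2 ^ d ≤ Nat.card {y : Fin d → ZMod 2 // ∀ i, x i ⬝ᵥ y = 0} * 2 ^ k := by
  set f := Matrix.mulVecLin (Matrix.of x) with hf
  have hker : Nat.card {y : Fin d → ZMod 2 // ∀ i, x i ⬝ᵥ y = 0} = Nat.card (LinearMap.ker f) := by
    refine Nat.card_congr (Equiv.subtypeEquivRight fun y => ?_)
    rw [LinearMap.mem_ker, hf, Matrix.mulVecLin_apply, funext_iff]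
    rfl
  have hcard : Nat.card (Fin d → ZMod 2) =
      Nat.card (LinearMap.ker f) * Nat.card (LinearMap.range f) := by
    rw [Submodule.card_eq_card_quotient_mul_card (LinearMap.ker f),
      Nat.card_congr f.quotKerEquivRange.toEquiv, mul_comm]
  have hrange : Nat.card (LinearMap.range f) ≤ 2 ^ k := by
    refine (Nat.card_le_card_of_injective _ Subtype.val_injective).trans ?_
    simp
  have hd : Nat.card (Fin d → ZMod 2) = 2 ^ d := by simp
  rw [← hd, hcard, hker]
  exact Nat.mul_le_mul_left _ hrange

theorem two_pow_le_card_orthogonalTuples_mul (k d : ℕ) :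
    2 ^ (d * k) ≤ Nat.card (orthogonalTuples k d) * 2 ^ (k * k) := by
  induction k with
  | zero =>
    have : Nonempty (orthogonalTuples 0 d) := ⟨⟨fun i => i.elim0, fun i => i.elim0⟩⟩
    simp
  | succ k ih =>
    have hinj : Nat.card (Σ x : orthogonalTuples k d,
        {y : Fin d → ZMod 2 // ∀ i, x.1 i ⬝ᵥ y = 0}) ≤ Nat.card (orthogonalTuples (k + 1) d) := by
      refine Nat.card_le_card_of_injective
        (fun p => ⟨Fin.cons p.2.1 p.1.1, ?_⟩) ?_
      · intro i j
        refine Fin.cases ?_ (fun i => ?_) i <;> refine Fin.cases ?_ (fun j => ?_) j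
        · simp
        · intro _
          simpa [dotProduct_comm] using p.2.2 j
        · intro _
          simpa using p.2.2 i
        · intro hij
          simpa using p.1.2 i j (fun h => hij (by rw [h]))
      · rintro ⟨⟨x, hx⟩, y, hy⟩ ⟨⟨x', hx'⟩, y', hy'⟩ h
        obtain ⟨rfl, rfl⟩ := Fin.cons_injective2 (Subtype.mk.inj h)
        rfl
    have hsum : Nat.card (orthogonalTuples k d) * 2 ^ d ≤
        Nat.card (Σ x : orthogonalTuples k d,
          {y : Fin d → ZMod 2 // ∀ i, x.1 i ⬝ᵥ y = 0}) * 2 ^ k := by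
      classical
      have := Fintype.ofFinite (orthogonalTuples k d)
      rw [Nat.card_sigma, Finset.sum_mul, Nat.card_eq_fintype_card]
      simpa using Finset.sum_le_sum fun (x : orthogonalTuples k d) (_ : x ∈ Finset.univ) =>
        card_le_card_orthogonal_mul x.1
    calc 2 ^ (d * (k + 1)) = 2 ^ (d * k) * 2 ^ d := by rw [← pow_add]; ring_nf
      _ ≤ Nat.card (orthogonalTuples k d) * 2 ^ (k * k) * 2 ^ d := Nat.mul_le_mul_right _ ih
      _ = Nat.card (orthogonalTuples k d) * 2 ^ d * 2 ^ (k * k) := by ring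
      _ ≤ Nat.card (orthogonalTuples (k + 1) d) * 2 ^ k * 2 ^ (k * k) :=
          Nat.mul_le_mul_right _ (hsum.trans (Nat.mul_le_mul_right _ hinj))
      _ = Nat.card (orthogonalTuples (k + 1) d) * 2 ^ (k + k * k) := by rw [pow_add]; ring
      _ ≤ _ := Nat.mul_le_mul_left _ (Nat.pow_le_pow_right (by norm_num) (by nlinarith))

/-- Mutually orthogonal sets of vectors of `𝔽₂ ^ d` span orthogonal subspaces, whose dimensions
add up to at most `d`. -/
theorem ncard_mul_ncard_le_of_orthogonal {d : ℕ} {S T : Set (Fin d → ZMod 2)}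
    (h : ∀ s ∈ S, ∀ t ∈ T, s ⬝ᵥ t = 0) : S.ncard * T.ncard ≤ 2 ^ d := by
  classical
  have hcard : ∀ U : Submodule (ZMod 2) (Fin d → ZMod 2),
      (U : Set (Fin d → ZMod 2)).ncard = 2 ^ Module.finrank (ZMod 2) U := fun U => by
    have := Module.natCard_eq_pow_finrank (K := ZMod 2) (V := U)
    rwa [Nat.card_zmod] at this
  let b := Matrix.toBilin' (1 : Matrix (Fin d) (Fin d) (ZMod 2))
  have hb : ∀ x y, b x y = x ⬝ᵥ y := fun x y => by
    simp [b, Matrix.toBilin'_apply']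
  have hnd : b.Nondegenerate :=
    Matrix.nondegenerate_toBilin'_iff.2 (Matrix.nondegenerate_of_det_ne_zero (by simp))
  set U := Submodule.span (ZMod 2) S
  have hT : T ⊆ b.orthogonal U := by
    intro t ht u hu
    change b u t = 0
    induction hu using Submodule.span_induction with
    | mem x hx => rw [hb]; exact h x hx t ht
    | zero => simp
    | add x y _ _ hx hy => simp [hx, hy]
    | smul a x _ hx => simp [hx]
  have hdim := LinearMap.BilinForm.finrank_orthogonal hnd U
  have hle := Submodule.finrank_le U
  calc S.ncard * T.ncard ≤ (U : Set _).ncard * (b.orthogonal U : Set _).ncard :=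
        Nat.mul_le_mul (Set.ncard_le_ncard Submodule.subset_span) (Set.ncard_le_ncard hT)
    _ = 2 ^ d := by
        rw [hcard, hcard, ← pow_add, hdim, Nat.add_sub_cancel' hle]
        simp

/-! ### Rectangles in circuits -/

namespace FactCircuit

variable {A B : Type*} (C : FactCircuit A B)

theorem wellFounded_wire : WellFounded C.wire := by
  have := C.finite
  have : Std.Irrefl (Relation.TransGen C.wire) := ⟨C.acyclic⟩
  exact Subrelation.wf (fun h => Relation.TransGen.single h)
    (Finite.wellFounded_of_trans_of_irrefl (Relation.TransGen C.wire))

variable {C}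

theorem memDom_iff {g : C.Gate} {a : A} : C.MemDom g a ↔
    (∃ b, C.label g = GateLabel.input a b) ∨ ∃ g', C.wire g' g ∧ C.MemDom g' a := by
  constructor
  · rintro (hg | ⟨hw, h⟩)
    exacts [Or.inl ⟨_, hg⟩, Or.inr ⟨_, hw, h⟩]
  · rintro (⟨b, hg⟩ | ⟨g', hw, h⟩)
    exacts [.input hg, .step hw h]

theorem produces_iff_of_input {g : C.Gate} {h : Set (A × B)} {a : A} {b : B}
    (hg : C.label g = GateLabel.input a b) : C.Produces g h ↔ h = {(a, b)} := by
  constructor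
  · rintro (hg' | ⟨hg', -⟩ | hg') <;> rw [hg] at hg' <;> cases hg'
    rfl
  · rintro rfl
    exact .input hg

theorem produces_iff_of_union {g : C.Gate} {h : Set (A × B)}
    (hg : C.label g = GateLabel.union) :
    C.Produces g h ↔ ∃ g', C.wire g' g ∧ C.Produces g' h := by
  constructor
  · rintro (hg' | ⟨-, hw, h'⟩ | hg')
    · rw [hg] at hg'; cases hg'
    · exact ⟨_, hw, h'⟩
    · rw [hg] at hg'; cases hg'
  · rintro ⟨g', hw, h'⟩
    exact .union hg hw h'

theorem produces_iff_of_prod {g : C.Gate} {h : Set (A × B)}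
    (hg : C.label g = GateLabel.prod) :
    C.Produces g h ↔ ∃ f : C.Gate → Set (A × B), (∀ g', C.wire g' g → C.Produces g' (f g')) ∧
      h = {p | ∃ g', C.wire g' g ∧ p ∈ f g'} := by
  constructor
  · rintro (hg' | ⟨hg', -⟩ | ⟨-, f, hf⟩)
    · rw [hg] at hg'; cases hg'
    · rw [hg] at hg'; cases hg'
    · exact ⟨f, hf, rfl⟩
  · rintro ⟨f, hf, rfl⟩
    exact .prod hg f hf

theorem Produces.fst_mem_dom {g : C.Gate} {h : Set (A × B)} (H : C.Produces g h) :
    ∀ p ∈ h, p.1 ∈ C.dom g := by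
  induction H with
  | input hg => rintro _ rfl; exact MemDom.input hg
  | union _ hw _ ih => exact fun p hp => MemDom.step hw (ih p hp)
  | prod _ f _ ih => rintro p ⟨g', hw, hp⟩; exact MemDom.step hw (ih g' hw p hp)

variable (C)

/-- The partial mappings computed at the gate `g` all of whose pairs lie in `P`. -/
def partials (P : Set (A × B)) (g : C.Gate) : Set (Set (A × B)) := {s | C.Produces g s ∧ s ⊆ P}

/-- The sets of pairs in `P` which complete every member of `C.partials P g` to a mapping
represented by the circuit. -/
def contexts (P : Set (A × B)) (g : C.Gate) : Set (Set (A × B)) :=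
  {t | t ⊆ P ∧ ∀ s ∈ C.partials P g, s ∪ t ∈ C.mappings}

/-- The elements `w` for which the pair `ρ i w` occurs in some member of `𝓢`. -/
def trace {ι W : Type*} (ρ : ι → W → A × B) (𝓢 : Set (Set (A × B))) (i : ι) : Set W :=
  {w | ∃ s ∈ 𝓢, ρ i w ∈ s}

/-- `h` encodes the tuple `x` if for every `i` the only pair of the form `ρ i w` in `h` is the one
with `w = x i`. -/
def Encodes {ι W : Type*} (ρ : ι → W → A × B) (h : Set (A × B)) (x : ι → W) : Prop :=
  ∀ i w, ρ i w ∈ h ↔ w = x i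

/-- The represented mappings contained in `P` encode exactly the tuples in `X`, the pairs
`ρ i w` belong to the element `a i` of `A`, and no two coordinates of tuples in `X` contain a
combinatorial rectangle with both sides larger than `r`. -/
structure IsEncoding {ι W : Type*} (P : Set (A × B)) (a : ι → A) (ρ : ι → W → A × B)
    (X : Set (ι → W)) (r : ℕ) : Prop where
  one_le : 1 ≤ r
  fst_eq : ∀ i w, (ρ i w).1 = a i
  decode : ∀ h ∈ C.mappings, h ⊆ P → ∃ x ∈ X, Encodes ρ h x
  encode : ∀ x ∈ X, ∃ h ∈ C.mappings, h ⊆ P ∧ Encodes ρ h x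
  rectangle : ∀ i j, i ≠ j → ∀ S T : Set W,
    (∀ s ∈ S, ∀ t ∈ T, ∃ x ∈ X, x i = s ∧ x j = t) → S.ncard ≤ r ∨ T.ncard ≤ r

variable {C} {ι W : Type*} {P : Set (A × B)} {a : ι → A} {ρ : ι → W → A × B}
  {X : Set (ι → W)} {r : ℕ}

/-- All traces of `𝓢` have at most `r` elements. -/
def SmallTraces (ρ : ι → W → A × B) (r : ℕ) (𝓢 : Set (Set (A × B))) : Prop :=
  ∀ i, (trace ρ 𝓢 i).ncard ≤ r

theorem IsEncoding.smallTraces_or (hC : C.IsEncoding P a ρ X r) (g : C.Gate) :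
    SmallTraces ρ r (C.partials P g) ∨ SmallTraces ρ r (C.contexts P g) := by
  by_contra! H
  obtain ⟨⟨i, hi⟩, j, hj⟩ : (∃ i, r < (trace ρ (C.partials P g) i).ncard) ∧
      ∃ j, r < (trace ρ (C.contexts P g) j).ncard := by
    simpa only [SmallTraces, not_forall, not_le] using H
  have key : ∀ w ∈ trace ρ (C.partials P g) i, ∀ w' ∈ trace ρ (C.contexts P g) j,
      ∃ x ∈ X, x i = w ∧ x j = w' := by
    rintro w ⟨s, hs, hw⟩ w' ⟨t, ht, hw'⟩
    obtain ⟨x, hx, hxs⟩ := hC.decode _ (ht.2 s hs) (Set.union_subset hs.2 ht.1)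
    exact ⟨x, hx, ((hxs i w).1 (Or.inl hw)).symm, ((hxs j w').1 (Or.inr hw')).symm⟩
  by_cases hij : i = j
  · subst hij
    -- all elements of the one trace equal all elements of the other
    obtain ⟨w', hw'⟩ :=
      Set.nonempty_of_ncard_ne_zero (by lia : (trace ρ (C.contexts P g) i).ncard ≠ 0)
    have hsub : trace ρ (C.partials P g) i ⊆ {w'} := by
      intro w hw
      obtain ⟨x, -, h1, h2⟩ := key w hw w' hw'
      exact h1.symm.trans h2
    have := Set.ncard_le_ncard hsub
    rw [Set.ncard_singleton] at this
    have := hC.one_le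
    lia
  · rcases hC.rectangle i j hij _ _ key with h | h <;> lia

/-- Wires and gates both give rise to rectangles: a wire combines the mappings of its source with
the contexts of its target, and a gate is treated like a wire from itself to itself. -/
abbrev Node (C : FactCircuit A B) := C.Gate ⊕ {p : C.Gate × C.Gate // C.wire p.1 p.2}

/-- The gate at which a node starts. -/
def Node.low : C.Node → C.Gate
  | .inl g => g
  | .inr p => p.1.1

/-- The gate at which a node ends. -/
def Node.high : C.Node → C.Gate
  | .inl g => g
  | .inr p => p.1.2

theorem smallTraces_input [Finite W] (hr : 1 ≤ r) (hρ : ∀ i, Function.Injective (ρ i)) {g : C.Gate}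
    {a : A} {b : B} (hg : C.label g = GateLabel.input a b) :
    SmallTraces ρ r (C.partials P g) := by
  intro i
  refine le_trans ?_ hr
  rw [Set.ncard_le_one_iff]
  rintro w w' ⟨s, hs, hw⟩ ⟨s', hs', hw'⟩
  rw [(produces_iff_of_input hg).1 hs.1] at hw
  rw [(produces_iff_of_input hg).1 hs'.1] at hw'
  exact hρ i (hw.trans hw'.symm)

/-- The domains of the children of a `×`-gate are disjoint, so that each trace of the gate is a
trace of one of its children. -/
theorem smallTraces_prod [Finite W] (hwd : C.WellDefined) (ha : ∀ i w, (ρ i w).1 = a i)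
    {g : C.Gate} (hg : C.label g = GateLabel.prod)
    (hsmall : ∀ g', C.wire g' g → SmallTraces ρ r (C.partials P g')) :
    SmallTraces ρ r (C.partials P g) := by
  have key : ∀ i, ∀ w ∈ trace ρ (C.partials P g) i,
      ∃ g', C.wire g' g ∧ a i ∈ C.dom g' ∧ w ∈ trace ρ (C.partials P g') i := by
    rintro i w ⟨s, ⟨hs, hsP⟩, hw⟩
    obtain ⟨f, hf, rfl⟩ := (produces_iff_of_prod hg).1 hs
    obtain ⟨g', hg', hw⟩ := hw
    refine ⟨g', hg', ?_, f g', ⟨hf g' hg', fun p hp => hsP ⟨g', hg', hp⟩⟩, hw⟩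
    rw [← ha i w]
    exact (hf g' hg').fst_mem_dom _ hw
  intro i
  rcases (trace ρ (C.partials P g) i).eq_empty_or_nonempty with h | ⟨w, hw⟩
  · simp [h]
  obtain ⟨g₁, hg₁, hd₁, -⟩ := key i w hw
  refine (Set.ncard_le_ncard fun w' hw' => ?_).trans (hsmall g₁ hg₁ i)
  obtain ⟨g₂, hg₂, hd₂, hw₂⟩ := key i w' hw'
  have : g₁ = g₂ := by
    by_contra hne
    exact Set.disjoint_left.1 (hwd.2 g hg g₁ g₂ hg₁ hg₂ hne) hd₁ hd₂
  rwa [this]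

theorem contexts_subset_of_union {g g' : C.Gate} (hg : C.label g = GateLabel.union)
    (hw : C.wire g' g) : C.contexts P g ⊆ C.contexts P g' :=
  fun _ ht => ⟨ht.1, fun s hs => ht.2 s ⟨hs.1.union hg hw, hs.2⟩⟩

theorem union_mem_contexts_of_prod {g g' : C.Gate} (hg : C.label g = GateLabel.prod)
    (hw : C.wire g' g) (f : C.Gate → Set (A × B)) (hf : ∀ g', C.wire g' g → C.Produces g' (f g'))
    (hP : ∀ g', C.wire g' g → f g' ⊆ P) {t : Set (A × B)} (ht : t ∈ C.contexts P g) :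
    {p | ∃ g'', C.wire g'' g ∧ g'' ≠ g' ∧ p ∈ f g''} ∪ t ∈ C.contexts P g' := by
  classical
  refine ⟨Set.union_subset ?_ ht.1, fun s hs => ?_⟩
  · rintro p ⟨g'', hw'', -, hp⟩
    exact hP g'' hw'' hp
  · have hprod : C.Produces g {p | ∃ g'', C.wire g'' g ∧ p ∈ Function.update f g' s g''} := by
      refine Produces.prod hg _ fun g'' hw'' => ?_
      by_cases h : g'' = g'
      · subst h; simpa using hs.1
      · simpa [h] using hf g'' hw''
    have heq : {p | ∃ g'', C.wire g'' g ∧ p ∈ Function.update f g' s g''} =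
        s ∪ {p | ∃ g'', C.wire g'' g ∧ g'' ≠ g' ∧ p ∈ f g''} := by
      ext p
      constructor
      · rintro ⟨g'', hw'', hp⟩
        by_cases h : g'' = g'
        · subst h; left; simpa using hp
        · right; exact ⟨g'', hw'', h, by simpa [h] using hp⟩
      · rintro (hp | ⟨g'', hw'', h, hp⟩)
        · exact ⟨g', hw, by simpa using hp⟩
        · exact ⟨g'', hw'', by simpa [h] using hp⟩
    rw [heq] at hprod
    rw [← Set.union_assoc]
    refine ht.2 _ ⟨hprod, Set.union_subset hs.2 ?_⟩
    rintro p ⟨g'', hw'', -, hp⟩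
    exact hP g'' hw'' hp

/-- Walking down from a gate with few contexts, along children which still have few contexts, one
gets stuck at a node with few mappings below it as well. -/
theorem IsEncoding.exists_node [Finite W] (hwd : C.WellDefined) (hρ : ∀ i, Function.Injective (ρ i))
    (hC : C.IsEncoding P a ρ X r) (g : C.Gate) :
    SmallTraces ρ r (C.contexts P g) → ∀ s ∈ C.partials P g, ∀ t ∈ C.contexts P g,
      ∃ e : C.Node, SmallTraces ρ r (C.partials P e.low) ∧ SmallTraces ρ r (C.contexts P e.high) ∧
        ∃ s' ∈ C.partials P e.low, ∃ t' ∈ C.contexts P e.high, s ∪ t = s' ∪ t' := by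
  induction g using C.wellFounded_wire.induction with
  | _ g ih =>
  intro hsmall s hs t ht
  obtain ⟨hs, hsP⟩ := hs
  cases hs with
  | input hg =>
    exact ⟨.inl g, smallTraces_input hC.one_le hρ hg, hsmall, _, ⟨.input hg, hsP⟩, t, ht, rfl⟩
  | @union _ g' _ hg hw hs =>
    rcases hC.smallTraces_or g' with h | h
    · exact ⟨.inr ⟨(g', g), hw⟩, h, hsmall, s, ⟨hs, hsP⟩, t, ht, rfl⟩
    · exact ih g' hw h s ⟨hs, hsP⟩ t (contexts_subset_of_union hg hw ht)
  | prod hg f hf =>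
    have hP : ∀ g', C.wire g' g → f g' ⊆ P := fun g' hw p hp => hsP ⟨g', hw, hp⟩
    by_cases h : ∃ g', C.wire g' g ∧ SmallTraces ρ r (C.contexts P g')
    · obtain ⟨g', hw, h⟩ := h
      obtain ⟨e, he₁, he₂, s', hs', t', ht', heq⟩ := ih g' hw h (f g') ⟨hf g' hw, hP g' hw⟩ _
        (union_mem_contexts_of_prod hg hw f hf hP ht)
      refine ⟨e, he₁, he₂, s', hs', t', ht', ?_⟩
      rw [← heq, ← Set.union_assoc]
      congr 1
      ext p
      constructor
      · rintro ⟨g'', hw'', hp⟩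
        by_cases h : g'' = g'
        · subst h; exact Or.inl hp
        · exact Or.inr ⟨g'', hw'', h, hp⟩
      · rintro (hp | ⟨g'', hw'', -, hp⟩)
        · exact ⟨g', hw, hp⟩
        · exact ⟨g'', hw'', hp⟩
    · push Not at h
      refine ⟨.inl g, smallTraces_prod hwd hC.fst_eq hg fun g' hw => ?_, hsmall, _,
        ⟨.prod hg f hf, hsP⟩, t, ht, rfl⟩
      exact (hC.smallTraces_or g').resolve_right (h g' hw)

theorem IsEncoding.smallTraces_contexts_sink [Finite W] (hC : C.IsEncoding P a ρ X r)
    {s : Set (A × B)} (hs : s ∈ C.partials P C.sink) :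
    SmallTraces ρ r (C.contexts P C.sink) := by
  intro i
  refine le_trans ?_ hC.one_le
  -- a context of the sink is added to the full mapping `s`, and hence has nothing new to add
  obtain ⟨x, -, hx⟩ := hC.decode s hs.1 hs.2
  have key : ∀ w ∈ trace ρ (C.contexts P C.sink) i, w = x i := by
    rintro w ⟨t, ht, hw⟩
    obtain ⟨y, -, hy⟩ := hC.decode _ (ht.2 s hs) (Set.union_subset hs.2 ht.1)
    rw [(hy i w).1 (Or.inr hw), (hy i (x i)).1 (Or.inl ((hx i (x i)).2 rfl))]
  rw [Set.ncard_le_one_iff]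
  intro w w' hw hw'
  rw [key w hw, key w' hw']

/-- Every tuple of `X` belongs to the rectangle of some node all of whose traces are small, and
such a rectangle contains at most `(2 * r) ^ card ι` tuples. -/
theorem IsEncoding.card_le [Finite W] [Fintype ι] (hwd : C.WellDefined)
    (hρ : ∀ i, Function.Injective (ρ i)) (hC : C.IsEncoding P a ρ X r) :
    Nat.card X ≤ C.size * (2 * r) ^ Fintype.card ι := by
  classical
  have := C.finite
  have := Fintype.ofFinite C.Node
  have := Fintype.ofFinite W
  let box (e : C.Node) : Finset (ι → W) := Fintype.piFinset fun i =>
    (trace ρ (C.partials P e.low) i ∪ trace ρ (C.contexts P e.high) i).toFinset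
  let small : Finset C.Node := Finset.univ.filter fun e =>
    SmallTraces ρ r (C.partials P e.low) ∧ SmallTraces ρ r (C.contexts P e.high)
  have hbox : ∀ e ∈ small, (box e).card ≤ (2 * r) ^ Fintype.card ι := by
    intro e he
    obtain ⟨-, h₁, h₂⟩ := Finset.mem_filter.1 he
    rw [Fintype.card_piFinset, ← Finset.card_univ]
    refine Finset.prod_le_pow_card _ _ _ fun i _ => ?_
    rw [← Set.ncard_eq_toFinset_card']
    refine (Set.ncard_union_le _ _).trans ?_
    have := h₁ i
    have := h₂ i
    lia
  have hcover : X.toFinset ⊆ small.biUnion box := by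
    intro x hx
    obtain ⟨h, hh, hP, henc⟩ := hC.encode x (Set.mem_toFinset.1 hx)
    have hs : h ∈ C.partials P C.sink := ⟨hh, hP⟩
    have hempty : ∅ ∈ C.contexts P C.sink :=
      ⟨Set.empty_subset _, fun s hs => by rw [Set.union_empty]; exact hs.1⟩
    obtain ⟨e, h₁, h₂, s', hs', t', ht', heq⟩ :=
      hC.exists_node hwd hρ C.sink (hC.smallTraces_contexts_sink hs) h hs ∅ hempty
    rw [Set.union_empty] at heq
    refine Finset.mem_biUnion.2 ⟨e, Finset.mem_filter.2 ⟨Finset.mem_univ _, h₁, h₂⟩, ?_⟩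
    refine Fintype.mem_piFinset.2 fun i => Set.mem_toFinset.2 ?_
    have hi : ρ i (x i) ∈ s' ∪ t' := heq ▸ (henc i (x i)).2 rfl
    exact hi.imp (fun h => ⟨s', hs', h⟩) fun h => ⟨t', ht', h⟩
  calc Nat.card X = X.toFinset.card := by rw [Nat.card_coe_set_eq, Set.ncard_eq_toFinset_card']
    _ ≤ (small.biUnion box).card := Finset.card_le_card hcover
    _ ≤ small.card * (2 * r) ^ Fintype.card ι := Finset.card_biUnion_le_card_mul _ _ _ hbox
    _ ≤ C.size * (2 * r) ^ Fintype.card ι := by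
      refine Nat.mul_le_mul_right _ ((Finset.card_le_univ _).trans ?_)
      rw [← Nat.card_eq_fintype_card, Nat.card_sum]
      rfl

end FactCircuit

/-! ### Existence of representations -/

namespace FactCircuit

/-- The wires of the circuit which lists all members of a family of mappings: the sink `none` is
the union of the gates `some (i, none)`, each of which is the product of the inputs
`some (i, some a)`. -/
def listingWire {M N : ℕ} :
    Option (Fin M × Option (Fin N)) → Option (Fin M × Option (Fin N)) → Prop
  | some (_, none), none => True
  | some (i, some _), some (j, none) => i = j
  | _, _ => False

/-- The height of a gate in the listing circuit. -/
def listingHeight {M N : ℕ} : Option (Fin M × Option (Fin N)) → ℕ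
  | none => 2
  | some (_, none) => 1
  | some (_, some _) => 0

theorem listingHeight_lt {M N : ℕ} {x y : Option (Fin M × Option (Fin N))}
    (h : listingWire x y) : listingHeight x < listingHeight y := by
  rcases x with _ | ⟨i, _ | a⟩ <;> rcases y with _ | ⟨j, _ | b⟩ <;>
    simp_all [listingWire, listingHeight]

/-- The circuit which lists the mappings `φ i`, where the source is enumerated by `e`. -/
def listing {A B : Type*} {M N : ℕ} (hM : 0 < M) (hN : 0 < N) (e : Fin N → A)
    (φ : Fin M → A → B) : FactCircuit A B where
  Gate := Option (Fin M × Option (Fin N))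
  finite := inferInstance
  wire := listingWire
  acyclic g h := by
    have : ∀ x y, Relation.TransGen (listingWire (M := M) (N := N)) x y →
        listingHeight x < listingHeight y := fun x y h => by
      induction h with
      | single h => exact listingHeight_lt h
      | tail _ h ih => exact ih.trans (listingHeight_lt h)
    exact lt_irrefl _ (this g g h)
  sink := none
  sink_iff := by
    rintro (_ | ⟨i, _ | a⟩)
    · simp [listingWire]
    · simpa using ⟨none, trivial⟩
    · simpa using ⟨some (i, none), rfl⟩
  label
    | none => .union
    | some (_, none) => .prod
    | some (i, some a) => .input (e a) (φ i (e a))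
  input_iff := by
    rintro (_ | ⟨i, _ | a⟩)
    · simpa using ⟨some (⟨0, hM⟩, none), trivial⟩
    · simpa using ⟨some (i, some ⟨0, hN⟩), rfl⟩
    · simp [listingWire]

section

variable {A B : Type*} {M N : ℕ} (hM : 0 < M) (hN : 0 < N) (e : Fin N → A) (φ : Fin M → A → B)

theorem listing_memDom_some {i : Fin M} {a : Fin N} {x : A}
    (h : (listing hM hN e φ).MemDom (some (i, some a)) x) : x = e a := by
  rcases memDom_iff.1 h with ⟨b, hb⟩ | ⟨g', hw, -⟩
  · cases hb; rfl
  · rcases g' with _ | ⟨j, _ | b⟩ <;> exact hw.elim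

theorem listing_dom_none (he : Function.Surjective e) (i : Fin M) :
    (listing hM hN e φ).dom (some (i, none)) = Set.univ := by
  refine Set.eq_univ_of_forall fun x => ?_
  obtain ⟨a, rfl⟩ := he x
  exact memDom_iff.2 (Or.inr ⟨some (i, some a), rfl, memDom_iff.2 (Or.inl ⟨φ i (e a), rfl⟩)⟩)

theorem listing_wellDefined (he : Function.Bijective e) : (listing hM hN e φ).WellDefined := by
  constructor
  · rintro (_ | ⟨i, _ | a⟩) hg
    · rintro (_ | ⟨j, _ | b⟩) hw
      · exact hw.elim
      · rw [listing_dom_none _ _ _ _ he.2]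
        refine (Set.eq_univ_of_forall fun x => ?_).symm
        refine MemDom.step hw ?_
        have : x ∈ (listing hM hN e φ).dom (some (j, none)) := by
          rw [listing_dom_none _ _ _ _ he.2]; trivial
        exact this
      · exact hw.elim
    · cases hg
    · cases hg
  · rintro (_ | ⟨i, _ | a⟩) hg
    · cases hg
    · have hchild : ∀ g', (listing hM hN e φ).wire g' (some (i, none)) →
          ∃ b, g' = some (i, some b) := by
        rintro (_ | ⟨j, _ | b⟩) hw
        · exact hw.elim
        · exact hw.elim
        · cases hw
          exact ⟨b, rfl⟩
      intro g₁ g₂ hw hw' hne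
      obtain ⟨b, rfl⟩ := hchild g₁ hw
      obtain ⟨b', rfl⟩ := hchild g₂ hw'
      refine Set.disjoint_left.2 fun x hx hx' => hne ?_
      have := (listing_memDom_some _ _ _ _ hx).symm.trans (listing_memDom_some _ _ _ _ hx')
      rw [he.1 this]
    · cases hg

theorem listing_produces_none (he : Function.Surjective e) {i : Fin M} {h : Set (A × B)} :
    (listing hM hN e φ).Produces (some (i, none)) h ↔ h = {p | p.2 = φ i p.1} := by
  have hinput : ∀ a h, (listing hM hN e φ).Produces (some (i, some a)) h ↔
      h = {(e a, φ i (e a))} := fun a h => produces_iff_of_input rfl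
  have hwire : ∀ f : (listing hM hN e φ).Gate → Set (A × B),
      (∀ a, f (some (i, some a)) = {(e a, φ i (e a))}) →
        {p | ∃ g', (listing hM hN e φ).wire g' (some (i, none)) ∧ p ∈ f g'} =
          {p | p.2 = φ i p.1} := by
    intro f hf
    ext ⟨x, y⟩
    constructor
    · rintro ⟨g', hw, hp⟩
      rcases g' with _ | ⟨j, _ | b⟩
      · exact hw.elim
      · exact hw.elim
      · cases hw
        rw [hf] at hp
        cases hp
        rfl
    · rintro hxy
      obtain ⟨a, rfl⟩ := he x
      refine ⟨some (i, some a), rfl, ?_⟩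
      rw [hf]
      exact Prod.ext rfl hxy
  refine (produces_iff_of_prod (C := listing hM hN e φ) rfl).trans ⟨?_, ?_⟩
  · rintro ⟨f, hf, rfl⟩
    exact hwire f fun a => (hinput a _).1 (hf _ rfl)
  · rintro rfl
    let f : Option (Fin M × Option (Fin N)) → Set (A × B)
      | some (i, some a) => {(e a, φ i (e a))}
      | _ => ∅
    refine ⟨f, ?_, (hwire f fun a => rfl).symm⟩
    rintro (_ | ⟨j, _ | b⟩) hw
    · exact hw.elim
    · exact hw.elim
    · cases hw
      exact (hinput b _).2 rfl

theorem listing_mappings (he : Function.Surjective e) :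
    (listing hM hN e φ).mappings = {h | ∃ i, h = {p | p.2 = φ i p.1}} := by
  ext h
  refine (produces_iff_of_union (C := listing hM hN e φ) rfl).trans ⟨?_, ?_⟩
  · rintro ⟨g', hw, h'⟩
    rcases g' with _ | ⟨j, _ | b⟩
    · exact hw.elim
    · exact ⟨j, (listing_produces_none hM hN e φ he).1 h'⟩
    · exact hw.elim
  · rintro ⟨i, hi⟩
    exact ⟨some (i, none), trivial, (listing_produces_none hM hN e φ he).2 hi⟩

end

theorem exists_isDRep (L : Language) {A B : Type*} [L.Structure A] [L.Structure B] [Finite A]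
    [Nonempty A] [Finite B] (φ₀ : A →[L] B) : ∃ C : FactCircuit A B, C.IsDRep L := by
  have : Finite (A →[L] B) := DFunLike.finite _
  obtain ⟨N, ⟨e⟩⟩ := Finite.exists_equiv_fin A
  obtain ⟨M, ⟨f⟩⟩ := Finite.exists_equiv_fin (A →[L] B)
  have hN : 0 < N := Fin.pos (e (Classical.arbitrary A))
  have hM : 0 < M := Fin.pos (f φ₀)
  refine ⟨listing hM hN e.symm (fun i => f.symm i),
    listing_wellDefined _ _ _ _ e.symm.bijective, ?_⟩
  rw [listing_mappings _ _ _ _ e.symm.surjective]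
  ext h
  constructor
  · rintro ⟨i, rfl⟩
    exact ⟨f.symm i, rfl⟩
  · rintro ⟨φ, rfl⟩
    exact ⟨f φ, by simp⟩

end FactCircuit

/-- A connected structure with one binary relation has at most one element more than it has
tuples. -/
theorem RelStr.card_le_of_connected {n m : ℕ} [Language.graph.Structure (Fin n)]
    (hc : RelStr.Connected Language.graph (Fin n))
    (hm : RelStr.size Language.graph (Fin n) ≤ (m : ℕ∞)) : n ≤ m + 1 := by
  set T := Σ R : (Σ n, Language.graph.Relations n), {x : Fin R.1 → Fin n // Structure.RelMap R.2 x}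
  have hT : ENat.card T ≤ m := hm
  have hfin : Finite T := by
    rw [← ENat.card_lt_top]
    exact hT.trans_lt (ENat.natCast_lt_top m)
  have hcard : Nat.card T ≤ m := by
    rw [ENat.card_eq_coe_natCard] at hT
    exact_mod_cast hT
  let f : T → Sym2 (Fin n)
    | ⟨⟨2, .adj⟩, x⟩ => s(x.1 0, x.1 1)
  have hsub : (RelStr.gaifman Language.graph (Fin n)).edgeSet ⊆ Set.range f := by
    intro z
    induction z with
    | _ a b =>
    rintro ⟨hne, l, R, x, hx, ⟨i, rfl⟩, ⟨j, rfl⟩⟩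
    cases R
    refine ⟨⟨⟨2, .adj⟩, ⟨x, hx⟩⟩, ?_⟩
    have hij : i ≠ j := fun h => hne (by rw [h])
    change s(x 0, x 1) = s(x i, x j)
    fin_cases i <;> fin_cases j <;> simp_all [Sym2.eq_swap]
  have h1 := hc.card_vert_le_card_edgeSet_add_one
  have h2 : Nat.card (RelStr.gaifman Language.graph (Fin n)).edgeSet ≤ Nat.card T :=
    (Nat.card_mono (Set.finite_range f) hsub).trans (Finite.card_range_le f)
  rw [Nat.card_fin] at h1
  lia

theorem bddAbove_minRepSize (A : Type*) [Language.graph.Structure A] (m : ℕ) :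
    BddAbove {d | ∃ (n : ℕ) (_ : Language.graph.Structure (Fin n)),
      RelStr.Connected Language.graph (Fin n) ∧
        RelStr.size Language.graph (Fin n) ≤ (m : ℕ∞) ∧
          d = minRepSize Language.graph A (Fin n)} := by
  have hfin : ∀ n, Finite (Language.graph.Structure (Fin n)) := fun n => by
    refine Finite.of_injective
      (fun (S : Language.graph.Structure (Fin n)) => (S.RelMap adj : (Fin 2 → Fin n) → Prop)) ?_
    rintro ⟨F, R⟩ ⟨F', R'⟩ h
    congr 1
    · funext l f
      exact f.elim
    · funext l r
      cases r
      exact h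
  refine Set.Finite.bddAbove (Set.Finite.subset (s := ⋃ n ∈ Set.Iic (m + 1), Set.range
    fun _ : Language.graph.Structure (Fin n) => minRepSize Language.graph A (Fin n)) ?_ ?_)
  · exact (Set.finite_Iic _).biUnion fun n _ => Set.finite_range _
  · rintro d ⟨n, S, hc, hm, rfl⟩
    exact Set.mem_biUnion (RelStr.card_le_of_connected hc hm) ⟨S, rfl⟩

/-! ### The target structure -/

section Target

variable {V : Type*} {k : ℕ}

/-- The edge relation of the target structure. Its elements are the pairs of a vertex of `G` and a
vector, and a hub `none` which has an edge to every element and serves to make the structure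
connected. An edge of `G` lifts to those pairs of elements whose vectors agree if it lies
inside a branch set of `c`, and are orthogonal if it joins two branch sets. -/
def targetAdj (G : SimpleGraph V) (c : V → Option (Fin k)) (d : ℕ) :
    Option (V × (Fin d → ZMod 2)) → Option (V × (Fin d → ZMod 2)) → Prop
  | none, _ => True
  | some _, none => False
  | some (u, x), some (v, y) => G.Adj u v ∧ (∀ i, c u = some i → c v = some i → x = y) ∧
      ∀ i j, i ≠ j → c u = some i → c v = some j → x ⬝ᵥ y = 0

/-- The target structure, carried over to `Fin N` along `e`. -/
@[reducible]
def targetStructure (G : SimpleGraph V) (c : V → Option (Fin k)) {d N : ℕ}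
    (e : Fin N ≃ Option (V × (Fin d → ZMod 2))) : Language.graph.Structure (Fin N) where
  funMap f := f.elim
  RelMap | .adj => fun x => targetAdj G c d (e (x 0)) (e (x 1))

theorem exists_hom_iff (G : SimpleGraph V) (c : V → Option (Fin k)) {d N : ℕ}
    (e : Fin N ≃ Option (V × (Fin d → ZMod 2))) (φ : V → Fin N) :
    (∃ ψ : @Language.Hom Language.graph V (Fin N) G.structure (targetStructure G c e),
      @Language.Hom.toFun _ _ _ G.structure (targetStructure G c e) ψ = φ) ↔
        ∀ u v, G.Adj u v → targetAdj G c d (e (φ u)) (e (φ v)) := by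
  let := G.structure
  let := targetStructure G c e
  constructor
  · rintro ⟨ψ, rfl⟩ u v huv
    exact ψ.map_rel' (n := 2) adj ![u, v] huv
  · intro h
    refine ⟨⟨φ, fun f => f.elim, fun {n} r => ?_⟩, rfl⟩
    cases r
    exact fun x hx => h _ _ hx

theorem connected_targetStructure (G : SimpleGraph V) (c : V → Option (Fin k)) {d N : ℕ}
    (e : Fin N ≃ Option (V × (Fin d → ZMod 2))) :
    @RelStr.Connected Language.graph (Fin N) (targetStructure G c e) := by
  let := targetStructure G c e
  refine (SimpleGraph.connected_iff_exists_forall_reachable _).2 ⟨e.symm none, fun z => ?_⟩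
  by_cases hz : e.symm none = z
  · rw [hz]
  · refine SimpleGraph.Adj.reachable ⟨hz, 2, adj, ![e.symm none, z], ?_, ⟨0, rfl⟩, ⟨1, rfl⟩⟩
    change targetAdj G c d (e (e.symm none)) (e z)
    rw [e.apply_symm_apply]
    trivial

theorem RelStr.size_graph_le {N : ℕ} [Language.graph.Structure (Fin N)] :
    RelStr.size Language.graph (Fin N) ≤ ((N ^ 2 : ℕ) : ℕ∞) := by
  let f : (Σ R : (Σ n, Language.graph.Relations n),
      {x : Fin R.1 → Fin N // Structure.RelMap R.2 x}) → Fin N × Fin N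
    | ⟨⟨2, .adj⟩, x⟩ => (x.1 0, x.1 1)
  have hf : Function.Injective f := by
    rintro ⟨⟨l, R⟩, x, hx⟩ ⟨⟨l', R'⟩, x', hx'⟩ h
    cases R
    cases R'
    obtain ⟨h0, h1⟩ := Prod.mk.inj h
    have : x = x' := by
      funext i
      fin_cases i
      exacts [h0, h1]
    subst this
    rfl
  refine (ENat.card_le_card_of_injective hf).trans ?_
  rw [ENat.card_eq_coe_natCard]
  simp [sq]

variable {G : SimpleGraph V} {c : V → Option (Fin k)}

/-- Along a homomorphism into the target structure that lies over the identity of `G`, the vector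
is constant on every branch set, and the vectors of two branch sets are orthogonal. -/
theorem mem_orthogonalTuples_of_targetAdj
    (hc : SimpleGraph.IsMinorModel (SimpleGraph.completeGraph (Fin k)) G c) {d : ℕ}
    {y : V → Fin d → ZMod 2}
    (hy : ∀ u v, G.Adj u v → targetAdj G c d (some (u, y u)) (some (v, y v)))
    {a : Fin k → V} (ha : ∀ i, c (a i) = some i) :
    (fun i => y (a i)) ∈ orthogonalTuples k d := by
  have hconst : ∀ i v, c v = some i → y v = y (a i) := fun i v hv =>
    hc.connected {z | y z = y (a i)} i
      (fun u v huv hu hv h => ((hy u v huv).2.1 i hu hv).symm.trans h) (a i) v (ha i) hv rfl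
  intro i j hij
  obtain ⟨u, v, hu, hv, huv⟩ := hc.adj i j hij
  have := (hy u v huv).2.2 i j hij hu hv
  rwa [hconst i u hu, hconst j v hv] at this

/-- The vector attached to a vertex by a tuple: constant on branch sets, and zero outside. -/
def spread (c : V → Option (Fin k)) {d : ℕ} (x : Fin k → Fin d → ZMod 2) (v : V) : Fin d → ZMod 2 :=
  (c v).elim 0 x

theorem targetAdj_spread {d : ℕ} {x : Fin k → Fin d → ZMod 2} (hx : x ∈ orthogonalTuples k d)
    {u v : V} (huv : G.Adj u v) :
    targetAdj G c d (some (u, spread c x u)) (some (v, spread c x v)) := by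
  refine ⟨huv, fun i hu hv => ?_, fun i j hij hu hv => ?_⟩
  · simp [spread, hu, hv]
  · simpa [spread, hu, hv] using hx i j hij

theorem isEncoding_target
    (hc : SimpleGraph.IsMinorModel (SimpleGraph.completeGraph (Fin k)) G c) {r N : ℕ}
    (e : Fin N ≃ Option (V × (Fin (2 * r) → ZMod 2))) {a : Fin k → V}
    (ha : ∀ i, c (a i) = some i) {C : FactCircuit V (Fin N)}
    (hC : C.mappings = {h | ∃ φ : V → Fin N,
      (∀ u v, G.Adj u v → targetAdj G c _ (e (φ u)) (e (φ v))) ∧ h = {p | p.2 = φ p.1}}) :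
    C.IsEncoding {p | ∃ w, e p.2 = some (p.1, w)} a
      (fun i w => (a i, e.symm (some (a i, w)))) (orthogonalTuples k (2 * r)) (2 ^ r) where
  one_le := Nat.one_le_two_pow
  fst_eq _ _ := rfl
  decode := by
    intro h hh hP
    rw [hC] at hh
    obtain ⟨φ, hφ, rfl⟩ := hh
    have hy : ∀ v, ∃ w, e (φ v) = some (v, w) := fun v => hP (show (v, φ v) ∈ _ from rfl)
    choose y hy using hy
    refine ⟨_, mem_orthogonalTuples_of_targetAdj hc (y := y) (fun u v huv => ?_) ha, ?_⟩
    · have := hφ u v huv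
      rwa [hy, hy] at this
    · intro i w
      change e.symm (some (a i, w)) = φ (a i) ↔ _
      rw [Equiv.symm_apply_eq, hy]
      simp
  encode := by
    intro x hx
    rw [hC]
    refine ⟨_, ⟨fun v => e.symm (some (v, spread c x v)), fun u v huv => ?_, rfl⟩, ?_, ?_⟩
    · simpa using targetAdj_spread hx huv
    · rintro ⟨v, b⟩ hb
      exact ⟨_, (congrArg e hb).trans (e.apply_symm_apply _)⟩
    · intro i w
      change e.symm (some (a i, w)) = e.symm (some (a i, spread c x (a i))) ↔ _
      simp [spread, ha]
  rectangle := by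
    intro i j hij S T h
    have := ncard_mul_ncard_le_of_orthogonal (S := S) (T := T) fun s hs t ht => by
      obtain ⟨x, hx, rfl, rfl⟩ := h s hs t ht
      exact hx i j hij
    by_contra! hST
    have h2 := Nat.mul_lt_mul'' hST.1 hST.2
    have hpow : 2 ^ (2 * r) = 2 ^ r * 2 ^ r := by rw [two_mul, pow_add]
    exact absurd (this.trans_eq hpow) h2.not_ge

/-- The target structure with vectors of length `2 * r` forces representations of size
`2 ^ (r * k)`, up to a constant factor. -/
theorem two_pow_le_worstRepSize [Finite V] [Nonempty V]
    (hc : SimpleGraph.IsMinorModel (SimpleGraph.completeGraph (Fin k)) G c) {r m : ℕ}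
    (hm : (Nat.card V * 4 ^ r + 1) ^ 2 ≤ m) :
    2 ^ (r * k) ≤ 2 ^ (k * k + k) * G.worstRepSize m := by
  classical
  choose a ha using hc.nonempty
  set N := Nat.card V * 4 ^ r + 1 with hN
  have hcard : Nat.card (Option (V × (Fin (2 * r) → ZMod 2))) = N := by
    rw [Finite.card_option, Nat.card_prod, hN, show 4 = 2 ^ 2 from rfl, ← pow_mul]
    simp
  let e : Fin N ≃ Option (V × (Fin (2 * r) → ZMod 2)) := (Finite.equivFinOfCardEq hcard).symm
  let := G.structure
  let := targetStructure G c e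
  have hφ₀ := (exists_hom_iff G c e fun v => e.symm (some (v, spread c 0 v))).2 fun u v huv => by
    have h0 : (0 : Fin k → Fin (2 * r) → ZMod 2) ∈ orthogonalTuples k (2 * r) :=
      fun i j _ => zero_dotProduct _
    simpa using targetAdj_spread h0 huv
  -- the infimum which defines `minRepSize` is attained
  obtain ⟨C, ⟨hwd, hmap⟩, hsize⟩ := Nat.sInf_mem (s := {s | ∃ C : FactCircuit V (Fin N),
    C.IsDRep Language.graph ∧ C.size = s}) <| by
      obtain ⟨C, hC⟩ := FactCircuit.exists_isDRep Language.graph hφ₀.choose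
      exact ⟨_, C, hC, rfl⟩
  have hworst : C.size ≤ G.worstRepSize m := by
    rw [hsize]
    refine le_csSup (bddAbove_minRepSize V m) ⟨N, _, connected_targetStructure G c e, ?_, rfl⟩
    exact RelStr.size_graph_le.trans (by exact_mod_cast hm)
  have henc := isEncoding_target hc e ha (C := C) <| by
    rw [hmap]
    ext h
    constructor
    · rintro ⟨ψ, rfl⟩
      exact ⟨ψ, (exists_hom_iff G c e ψ).1 ⟨ψ, rfl⟩, rfl⟩
    · rintro ⟨φ, hφ, rfl⟩
      obtain ⟨ψ, rfl⟩ := (exists_hom_iff G c e φ).2 hφ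
      exact ⟨ψ, rfl⟩
  have hle := henc.card_le hwd fun i w w' h => by simpa using h
  rw [Fintype.card_fin] at hle
  have htuples := two_pow_le_card_orthogonalTuples_mul k (2 * r)
  refine Nat.le_of_mul_le_mul_right (c := 2 ^ (r * k)) ?_ (by positivity)
  calc 2 ^ (r * k) * 2 ^ (r * k) = 2 ^ (2 * r * k) := by rw [← pow_add]; ring_nf
    _ ≤ C.size * (2 * 2 ^ r) ^ k * 2 ^ (k * k) := htuples.trans (Nat.mul_le_mul_right _ hle)
    _ = 2 ^ (k * k + k) * C.size * 2 ^ (r * k) := by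
      rw [mul_pow, ← pow_mul, pow_add]; ring
    _ ≤ _ := by gcongr

end Target

/-! ### Asymptotics -/

theorem rpow_le_worstRepSize {V : Type*} [Finite V] [Nonempty V] {G : SimpleGraph V} {k : ℕ}
    {c : V → Option (Fin k)}
    (hc : SimpleGraph.IsMinorModel (SimpleGraph.completeGraph (Fin k)) G c) :
    (fun m : ℕ => (m : ℝ) ^ ((k : ℝ) / 4)) =O[Filter.atTop]
      (fun m : ℕ => (G.worstRepSize m : ℝ)) := by
  set v := Nat.card V
  have hv : 1 ≤ v := Nat.card_pos
  refine Asymptotics.IsBigO.of_bound ((64 * (v : ℝ) ^ 2) ^ ((k : ℝ) / 4) * 2 ^ (k * k + k)) ?_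
  filter_upwards [Filter.eventually_ge_atTop (4 * v ^ 2)] with m hm
  -- the largest `r` such that the target structure has at most `m` tuples, up to a constant
  set r := Nat.log 16 (m / (4 * v ^ 2)) with hr
  have hpos : 0 < 4 * v ^ 2 := by positivity
  have hdiv : m / (4 * v ^ 2) ≠ 0 := (Nat.div_pos hm hpos).ne'
  have h1 : 16 ^ r * (4 * v ^ 2) ≤ m :=
    (Nat.le_div_iff_mul_le hpos).1 (Nat.pow_log_le_self 16 hdiv)
  have h2 : m < 16 ^ (r + 1) * (4 * v ^ 2) :=
    (Nat.div_lt_iff_lt_mul hpos).1 (Nat.lt_pow_succ_log_self (by norm_num) _)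
  have hsize : (v * 4 ^ r + 1) ^ 2 ≤ m := by
    refine le_trans ?_ h1
    have h4 : 1 ≤ v * 4 ^ r := Nat.mul_pos hv (by positivity)
    calc (v * 4 ^ r + 1) ^ 2 ≤ (2 * (v * 4 ^ r)) ^ 2 := Nat.pow_le_pow_left (by lia) 2
      _ = 16 ^ r * (4 * v ^ 2) := by
        rw [show 16 = 4 ^ 2 from rfl, ← pow_mul, mul_comm 2 r, pow_mul]; ring
  have hmain : (2 : ℝ) ^ (r * k) ≤ 2 ^ (k * k + k) * G.worstRepSize m := by
    exact_mod_cast two_pow_le_worstRepSize hc hsize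
  have h16 : ((16 : ℝ) ^ r) ^ ((k : ℝ) / 4) = 2 ^ (r * k) := by
    rw [show (16 : ℝ) = 2 ^ (4 : ℕ) by norm_num, ← pow_mul, ← Real.rpow_natCast,
      ← Real.rpow_mul (by norm_num), ← Real.rpow_natCast]
    congr 1
    push_cast
    ring
  rw [Real.norm_of_nonneg (by positivity), Real.norm_of_nonneg (by positivity)]
  calc (m : ℝ) ^ ((k : ℝ) / 4) ≤ ((64 * (v : ℝ) ^ 2) * 16 ^ r) ^ ((k : ℝ) / 4) := by
        refine Real.rpow_le_rpow (by positivity) ?_ (by positivity)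
        have : (m : ℝ) ≤ 16 ^ (r + 1) * (4 * v ^ 2) := by exact_mod_cast h2.le
        refine this.trans (le_of_eq ?_)
        ring
    _ = (64 * (v : ℝ) ^ 2) ^ ((k : ℝ) / 4) * 2 ^ (r * k) := by
        rw [Real.mul_rpow (by positivity) (by positivity), h16]
    _ ≤ (64 * (v : ℝ) ^ 2) ^ ((k : ℝ) / 4) * (2 ^ (k * k + k) * G.worstRepSize m) := by
        gcongr
    _ = _ := by ring

theorem corollary10 {V : Type*} [Finite V] (G : SimpleGraph V) (hG : G.Connected)
    (k : ℕ) (hk : SimpleGraph.IsMinorOf (SimpleGraph.completeGraph (Fin k)) G) :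
    (fun m : ℕ => (m : ℝ) ^ ((k : ℝ) / 4) / (Real.log (m : ℝ)) ^ ((3 * (k : ℝ) - 1) / 2))
      =O[Filter.atTop] (fun m : ℕ => (G.worstRepSize m : ℝ)) := by
  have := hG.nonempty
  rcases Nat.eq_zero_or_pos k with rfl | hk0
  · -- the exponent of the logarithm is negative here; the bound for `k = 1` is stronger
    obtain ⟨c, hc⟩ := SimpleGraph.exists_isMinorModel_one G
    refine Asymptotics.IsBigO.trans ?_ (rpow_le_worstRepSize hc)
    have h := ((isLittleO_log_rpow_rpow_atTop (1 / 2) (by norm_num : (0 : ℝ) < 1 / 4)).comp_tendsto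
      tendsto_natCast_atTop_atTop).isBigO
    refine h.congr' ?_ ?_
    · filter_upwards [Filter.eventually_ge_atTop 1] with m hm
      have hlog : 0 ≤ Real.log (m : ℝ) := Real.log_natCast_nonneg m
      simp only [Function.comp_apply, Nat.cast_zero, zero_div, Real.rpow_zero, mul_zero, zero_sub]
      rw [neg_div, Real.rpow_neg hlog, one_div, one_div, inv_inv]
    · exact Filter.Eventually.of_forall fun m => by simp
  · obtain ⟨c, hc⟩ := hk.exists_isMinorModel
    refine Asymptotics.IsBigO.trans ?_ (rpow_le_worstRepSize hc)
    refine Asymptotics.IsBigO.of_bound 1 ?_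
    have hlog : ∀ᶠ m : ℕ in Filter.atTop, 1 ≤ Real.log (m : ℝ) :=
      (Real.tendsto_log_atTop.comp tendsto_natCast_atTop_atTop).eventually_ge_atTop 1
    filter_upwards [hlog] with m hm
    have hk1 : (1 : ℝ) ≤ k := by exact_mod_cast hk0
    have hpow : 1 ≤ Real.log (m : ℝ) ^ ((3 * (k : ℝ) - 1) / 2) :=
      Real.one_le_rpow hm (by linarith)
    rw [Real.norm_of_nonneg (by positivity), Real.norm_of_nonneg (by positivity), one_mul]
    exact div_le_self (by positivity) hpow
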